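/- For every odd integer $N > 1$, the series $$S_N=\sum_{n=1}^{\infty}\frac{1}{n\left(e^{2\pi n^N}-1\right)}\qquad\text{and}\qquad T_{N,j}=\sum_{n=1}^{\infty}\frac{1}{n}\,\mathrm{Re}\left(\frac{1}{\exp\left(2\pi n^{1/N}e^{i\pi j/N}\right)-1}\right)\quad\left(j\in\mathbb{Z},\ 0\le j\le \tfrac{N-1}{2}\right)$$ converge, and at least one of the real numbers $\gamma$, $S_N$, $T_{N,0},T_{N,1},\dots,T_{N,(N-1)/2}$ is transcendental (over $\mathbb{Q}$), where $\gamma=\lim_{m\to\infty}\left(\sum_{k=1}^{m}\frac1k-\log m\right)$ is Euler's constant. -/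

import Mathlib

/-! Write N = 2M+1. The quantities are tied together by an identity qπ^N = 2S_N + (1 - 1/N)γ - (2/N)
Σ_k (-1)^k T_k with q a nonzero rational (`exists_rat_lambert_transformation`); the T_k reduce to
the T_{N,j} by complex conjugation. If all the numbers were algebraic, π^N and hence π would be
algebraic, contrary to `Real.transcendental_pi`.

The identity comes from summing n^(2M)/(n^(2N) + m²) over n, m ≥ 1 in both orders. The partial
fractions of coth evaluate each row (`hasSum_pow_div_row`), giving S_N and ζ(N+1), and, after
splitting over roots of unity, each column (`hasSum_pow_div_column`), giving the T_k. The double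
series diverges, so it is cut to n ≤ P, m ≤ P^N. The row tails and the column tails are both Riemann
sums tending to (1/N)∫₀¹ arctan x / x dx, so they cancel (`tendsto_sum_rows_sub_sum_columns`). The
harmonic sums left over produce γ, and Euler's formula makes ζ(N+1) a rational multiple of π^(N+1).
-/

/-! ### Transcendence of π by the Hermite–Lindemann method. -/

open Polynomial in
theorem exists_int_polynomial_of_galois_invariant {E : Type*} [Field E] [Algebra ℚ E]
    [FiniteDimensional ℚ E] [IsGalois ℚ E] (B : Multiset E)
    (hB : ∀ σ : E ≃ₐ[ℚ] E, B.map σ = B) :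
    ∃ f : ℤ[X], f ≠ 0 ∧ f.aroots E = B := by
  set F : E[X] := (B.map fun b => X - C b).prod with hF
  have hFmonic : F.Monic := monic_multiset_prod_of_monic _ _ fun b _ => monic_X_sub_C b
  have hFinv (σ : E ≃ₐ[ℚ] E) : F.map (σ : E →+* E) = F := by
    rw [hF, Polynomial.map_multiset_prod, Multiset.map_map]
    conv_rhs => rw [← hB σ, Multiset.map_map]
    congr 1
    refine Multiset.map_congr rfl fun b _ => ?_
    simp
  have hlift : F ∈ Polynomial.lifts (algebraMap ℚ E) := by
    rw [Polynomial.lifts_iff_coeff_lifts]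
    intro n
    rw [IsGalois.mem_range_algebraMap_iff_fixed]
    intro σ
    have := congrArg (fun p => p.coeff n) (hFinv σ)
    simpa using this
  obtain ⟨G, hG⟩ := (Polynomial.mem_lifts _).1 hlift
  obtain ⟨b, hbmem, hb⟩ := IsLocalization.integerNormalization_spec (nonZeroDivisors ℤ) G
  have hb0 : b ≠ 0 := nonZeroDivisors.ne_zero hbmem
  set f := IsLocalization.integerNormalization (nonZeroDivisors ℤ) G
  have hfE : f.map (algebraMap ℤ E) = C (b : E) * F := by
    have h1 : f.map (algebraMap ℤ E) = (f.map (algebraMap ℤ ℚ)).map (algebraMap ℚ E) := by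
      rw [Polynomial.map_map, RingHom.ext_int ((algebraMap ℚ E).comp (algebraMap ℤ ℚ))]
    rw [h1, hb, ← hG]
    ext n
    simp
  have hbE : (b : E) ≠ 0 := by
    have : CharZero E := algebraRat.charZero E
    exact_mod_cast hb0
  have : CharZero E := algebraRat.charZero E
  refine ⟨f, ?_, ?_⟩
  · intro h0
    rw [h0, Polynomial.map_zero] at hfE
    exact mul_ne_zero (C_ne_zero.2 hbE) hFmonic.ne_zero hfE.symm
  · rw [aroots_def, hfE, roots_C_mul _ hbE, hF, roots_multiset_prod_X_sub_C]

-- The product of r with the leading coefficient of f is integral; n further factors of that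
-- coefficient clear every monomial of g.
open Polynomial in
theorem isIntegral_leadingCoeff_pow_mul_aeval {E : Type*} [Field E] [CharZero E]
    {f g : ℤ[X]} {r : E} (hr : aeval r f = 0) {n : ℕ} (hn : g.natDegree ≤ n) :
    IsIntegral ℤ ((f.leadingCoeff : E) ^ n * aeval r g) := by
  have hint : IsIntegral ℤ ((f.leadingCoeff : E) * r) := by
    have := isIntegral_leadingCoeff_smul f r hr
    rwa [zsmul_eq_mul] at this
  rw [aeval_eq_sum_range' (Nat.lt_succ_of_le hn), Finset.mul_sum]
  refine IsIntegral.sum _ fun i hi => ?_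
  have hi' : i ≤ n := Nat.lt_succ_iff.1 (Finset.mem_range.1 hi)
  have : (f.leadingCoeff : E) ^ n * g.coeff i • r ^ i =
      ((g.coeff i * f.leadingCoeff ^ (n - i) : ℤ) : E) * ((f.leadingCoeff : E) * r) ^ i := by
    rw [zsmul_eq_mul, mul_pow]
    push_cast
    rw [← Nat.sub_add_cancel hi', pow_add]
    simp only [Nat.sub_add_cancel hi']
    ring
  rw [this]
  exact (isIntegral_algebraMap (x := (g.coeff i * f.leadingCoeff ^ (n - i) : ℤ))).mul (hint.pow i)

theorem exists_int_of_isIntegral_of_fixed {E : Type*} [Field E] [Algebra ℚ E]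
    [FiniteDimensional ℚ E] [IsGalois ℚ E] {x : E} (hx : IsIntegral ℤ x)
    (hfix : ∀ σ : E ≃ₐ[ℚ] E, σ x = x) : ∃ z : ℤ, (z : E) = x := by
  obtain ⟨q, rfl⟩ := (IsGalois.mem_range_algebraMap_iff_fixed x).2 hfix
  have hq : IsIntegral ℤ q := by
    have := algebraRat.charZero E
    exact (isIntegral_algebraMap_iff (algebraMap ℚ E).injective).1 hx
  obtain ⟨z, rfl⟩ := IsIntegrallyClosed.isIntegral_iff.1 hq
  exact ⟨z, by simp⟩

open Polynomial in
/-- A positive integer plus the sum of the exponentials of a Galois-stable multiset of nonzero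
algebraic numbers does not vanish. -/
theorem natCast_add_sum_exp_ne_zero {E : Type*} [Field E] [Algebra ℚ E]
    [FiniteDimensional ℚ E] [IsGalois ℚ E] (φ : E →ₐ[ℚ] ℂ) (B : Multiset E)
    (hB : ∀ σ : E ≃ₐ[ℚ] E, B.map σ = B) (h0 : (0 : E) ∉ B) {k : ℕ} (hk : 0 < k) :
    (k : ℂ) + (B.map fun b => Complex.exp (φ b)).sum ≠ 0 := by
  intro hsum
  have hchar : CharZero E := algebraRat.charZero E
  obtain ⟨f, hf0, hroots⟩ := exists_int_polynomial_of_galois_invariant B hB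
  have hmem {b : E} (hb : b ∈ B) : aeval b f = 0 := by
    rw [← hroots, mem_aroots] at hb
    exact hb.2
  have hev : f.eval 0 ≠ 0 := by
    intro h
    apply h0
    rw [← hroots, mem_aroots]
    refine ⟨hf0, ?_⟩
    have := aeval_algebraMap_apply_eq_algebraMap_eval (A := E) (0 : ℤ) f
    simpa [h] using this
  -- Hermite's approximation: for large primes p there are n prime to p and an integer polynomial g
  -- with n·exp r within c^p/(p-1)! of p·g(r) at every root r of f.
  obtain ⟨c, hc⟩ := LindemannWeierstrass.exp_polynomial_approx f hev
  set a : ℤ := f.leadingCoeff with ha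
  have ha0 : a ≠ 0 := leadingCoeff_ne_zero.2 hf0
  set d : ℕ := f.natDegree
  -- for large primes we get a nonzero integer of small absolute value
  have key : ∀ p : ℕ, p.Prime → (f.eval 0).natAbs < p → k < p → a.natAbs < p →
      1 ≤ (B.card : ℝ) * ((|(a : ℝ)| ^ d * |c|) ^ p / (p - 1).factorial) := by
    intro p hp h1 h2 h3
    obtain ⟨n, hn, g, hg, happ⟩ := hc p h1 hp
    have hgd : g.natDegree ≤ p * d := hg.trans (Nat.sub_le _ _)
    obtain ⟨z, hz⟩ : ∃ z : ℤ, (z : E) = (a : E) ^ (p * d) * (B.map fun b => aeval b g).sum := by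
      apply exists_int_of_isIntegral_of_fixed
      · rw [← Multiset.sum_map_mul_left]
        refine IsIntegral.multiset_sum fun x hx => ?_
        obtain ⟨b, hb, rfl⟩ := Multiset.mem_map.1 hx
        exact isIntegral_leadingCoeff_pow_mul_aeval (hmem hb) hgd
      · intro σ
        rw [map_mul, map_pow, map_intCast, map_multiset_sum, Multiset.map_map]
        congr 2
        conv_rhs => rw [← hB σ, Multiset.map_map]
        refine Multiset.map_congr rfl fun b _ => ?_
        exact (aeval_algHom_apply (σ.toAlgHom.restrictScalars ℤ) b g).symm
    have hz' : (z : ℂ) = (a : ℂ) ^ (p * d) * (B.map fun b => aeval (φ b) g).sum := by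
      have := congrArg φ hz
      rw [map_intCast, map_mul, map_pow, map_intCast, map_multiset_sum, Multiset.map_map] at this
      rw [this]
      congr 2
      refine Multiset.map_congr rfl fun b _ => ?_
      exact (aeval_algHom_apply (φ.restrictScalars ℤ) b g).symm
    -- This is the supposed relation times n·a^(pd), with each n·exp b replaced by p·g(b). Modulo p
    -- only a^(pd)·n·k survives, and p divides none of a, n, k.
    set w : ℤ := a ^ (p * d) * (n * k) + p * z with hw
    have hw0 : w ≠ 0 := by
      intro h
      have hdvd : (p : ℤ) ∣ a ^ (p * d) * (n * k) :=
        ⟨-z, by linear_combination h⟩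
      have hpi : Prime (p : ℤ) := Nat.prime_iff_prime_int.1 hp
      rcases hpi.dvd_or_dvd hdvd with h | h
      · have := Int.natAbs_dvd_natAbs.2 (hpi.dvd_of_dvd_pow h)
        exact absurd (Nat.le_of_dvd (Int.natAbs_pos.2 ha0) this) (by simpa using h3)
      · rcases hpi.dvd_or_dvd h with h | h
        · exact hn h
        · exact absurd (Nat.le_of_dvd hk (Int.natCast_dvd_natCast.1 h)) (by omega)
    have hwC : (w : ℂ) = -((a : ℂ) ^ (p * d) *
        (B.map fun b => n • Complex.exp (φ b) - p • aeval (φ b) g).sum) := by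
      rw [Multiset.sum_map_sub, hw]
      simp only [zsmul_eq_mul, nsmul_eq_mul, Multiset.sum_map_mul_left]
      push_cast
      rw [hz']
      linear_combination (a : ℂ) ^ (p * d) * n * hsum
    have hbound : ‖(B.map fun b => n • Complex.exp (φ b) - p • aeval (φ b) g).sum‖ ≤
        B.card * (|c| ^ p / (p - 1).factorial) := by
      refine (norm_multiset_sum_le _).trans ?_
      rw [Multiset.map_map, ← nsmul_eq_mul]
      refine (Multiset.sum_le_card_nsmul _ (|c| ^ p / (p - 1).factorial) ?_).trans (by simp)
      intro x hx
      obtain ⟨b, hb, rfl⟩ := Multiset.mem_map.1 hx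
      refine (happ (r := φ b) ?_).trans ?_
      · rw [mem_aroots]
        refine ⟨hf0, ?_⟩
        have := aeval_algHom_apply (φ.restrictScalars ℤ) b f
        rw [hmem hb, map_zero] at this
        exact this
      · rw [← abs_pow]
        gcongr
        exact le_abs_self _
    have h1w : (1 : ℝ) ≤ ‖(w : ℂ)‖ := by
      rw [Complex.norm_intCast]
      exact_mod_cast Int.one_le_abs hw0
    refine h1w.trans ?_
    rw [hwC, norm_neg, norm_mul, norm_pow, Complex.norm_intCast]
    calc |(a : ℝ)| ^ (p * d) * _ ≤ |(a : ℝ)| ^ (p * d) * (B.card * (|c| ^ p / (p - 1).factorial)) := by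
          gcongr
      _ = _ := by rw [mul_comm p d, pow_mul, mul_pow]; ring
  have hlim : Filter.Tendsto (fun p : ℕ => (B.card : ℝ) *
      ((|(a : ℝ)| ^ d * |c|) ^ p / (p - 1).factorial)) Filter.atTop (nhds 0) := by
    rw [← Filter.tendsto_add_atTop_iff_nat 1]
    have := (FloorSemiring.tendsto_pow_div_factorial_atTop (|(a : ℝ)| ^ d * |c|)).const_mul
      ((B.card : ℝ) * (|(a : ℝ)| ^ d * |c|))
    rw [mul_zero] at this
    refine this.congr fun p => ?_
    rw [Nat.add_sub_cancel, pow_succ]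
    ring
  obtain ⟨p₀, hp₀⟩ := Filter.eventually_atTop.1 (hlim.eventually_lt_const one_pos)
  obtain ⟨p, hpge, hp⟩ := Nat.exists_infinite_primes (p₀ + (f.eval 0).natAbs + k + a.natAbs + 1)
  exact absurd (key p hp (by omega) (by omega) (by omega)) (not_le.2 (hp₀ p (by omega)))

theorem prod_one_add_exp_eq_sum_powerset (s : Multiset ℂ) :
    (s.map fun x => 1 + Complex.exp x).prod =
      (s.powerset.map fun t => Complex.exp t.sum).sum := by
  simp only [Multiset.prod_map_add, Multiset.map_const', Multiset.prod_replicate, one_pow, one_mul]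
  rw [← Multiset.antidiagonal_map_snd, Multiset.map_map]
  refine congrArg Multiset.sum (Multiset.map_congr rfl fun t _ => ?_)
  rw [Function.comp_apply, Complex.exp_multiset_sum]

theorem Multiset.powerset_map {α β : Type*} (f : α → β) (s : Multiset α) :
    (s.map f).powerset = s.powerset.map (Multiset.map f) := by
  induction s using Multiset.induction_on with
  | empty => simp
  | cons a s ih => simp [ih, Multiset.map_map]

-- Since 1 + exp(iπ) = 0, the product of 1 + exp θ over the conjugates θ of iπ vanishes. Expanded,
-- it is a sum of exponentials of subset sums, a Galois-stable multiset, contradicting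
-- `natCast_add_sum_exp_ne_zero`.
open Polynomial in
theorem Real.transcendental_pi : Transcendental ℚ Real.pi := by
  intro halg
  have hθ : IsAlgebraic ℚ (Complex.I * Real.pi) := by
    refine IsAlgebraic.mul ?_ (halg.algebraMap (A := ℂ))
    exact ⟨X ^ 2 + 1, (by monicity! : (X ^ 2 + 1 : ℚ[X]).Monic).ne_zero, by simp⟩
  set P := minpoly ℚ (Complex.I * (Real.pi : ℂ)) with hP
  have hP0 : P ≠ 0 := minpoly.ne_zero hθ.isIntegral
  let E := P.SplittingField
  have hchar : CharZero E := algebraRat.charZero E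
  have : FiniteDimensional ℚ E := inferInstance
  have : IsSplittingField ℚ E P := IsSplittingField.splittingField P
  have : IsGalois ℚ E :=
    IsGalois.of_separable_splitting_field (p := P) (minpoly.irreducible hθ.isIntegral).separable
  let φ : E →ₐ[ℚ] ℂ := IsAlgClosed.lift
  have hsplit : (P.map (algebraMap ℚ E)).Splits := SplittingField.splits P
  set R : Multiset E := P.aroots E with hR
  have hRσ (σ : E ≃ₐ[ℚ] E) : R.map σ = R := by
    have h := hsplit.roots_map (σ : E →+* E)
    rw [Polynomial.map_map] at h
    have h2 : (σ : E →+* E).comp (algebraMap ℚ E) = algebraMap ℚ E := RingHom.ext fun x => by simp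
    rw [h2] at h
    exact h.symm
  have hRφ : R.map φ = P.aroots ℂ := by
    have h := hsplit.roots_map (φ : E →+* ℂ)
    rw [Polynomial.map_map] at h
    have h2 : (φ : E →+* ℂ).comp (algebraMap ℚ E) = algebraMap ℚ ℂ := RingHom.ext fun x => by simp
    rw [h2] at h
    exact h.symm
  have hmem : Complex.I * (Real.pi : ℂ) ∈ R.map φ := by
    rw [hRφ, mem_aroots]
    exact ⟨hP0, minpoly.aeval _ _⟩
  have hprod : ((R.map φ).map fun x => 1 + Complex.exp x).prod = 0 := by
    rw [Multiset.prod_eq_zero_iff]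
    refine Multiset.mem_map.2 ⟨_, hmem, ?_⟩
    rw [mul_comm, Complex.exp_pi_mul_I]
    ring
  classical
  set S : Multiset E := R.powerset.map Multiset.sum with hS
  have hSσ (σ : E ≃ₐ[ℚ] E) : S.map σ = S := by
    conv_rhs => rw [hS, ← hRσ σ, Multiset.powerset_map]
    simp [hS, Multiset.map_map, map_multiset_sum]
  have hsum : (S.map fun b => Complex.exp (φ b)).sum = 0 := by
    rw [← hprod, prod_one_add_exp_eq_sum_powerset, Multiset.powerset_map, hS]
    simp [Multiset.map_map, map_multiset_sum]
  have hsplit0 := Multiset.filter_add_not (fun b => b = 0) S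
  -- The vanishing subset sums each contribute exp 0 = 1; the empty subset ensures that there is at
  -- least one.
  refine natCast_add_sum_exp_ne_zero φ (S.filter fun b => ¬ b = 0) ?_ (by simp)
    (k := S.count 0) ?_ ?_
  · intro σ
    conv_rhs => rw [← hSσ σ, Multiset.filter_map]
    simp
  · rw [Multiset.count_pos, hS]
    exact Multiset.mem_map.2 ⟨0, by simp, by simp⟩
  · rw [← hsum]
    conv_rhs => rw [← hsplit0]
    have hz : S.filter (fun b => b = 0) = Multiset.replicate (S.count 0) 0 := by
      convert Multiset.filter_eq' S 0
    rw [Multiset.map_add, Multiset.sum_add, hz]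
    simp

/-! ### Partial fractions of the hyperbolic cotangent. -/

theorem Complex.mul_I_mem_integerComplement {c : ℂ} (hc : 0 < c.re) :
    Complex.I * c ∈ Complex.integerComplement := by
  rintro ⟨n, hn⟩
  have := congrArg Complex.im hn
  simp at this
  exact hc.ne this

theorem Complex.exp_sub_one_ne_zero_of_re_pos {z : ℂ} (hz : 0 < z.re) : Complex.exp z - 1 ≠ 0 := by
  intro h
  have h1 : ‖Complex.exp z‖ = 1 := by rw [sub_eq_zero.1 h, norm_one]
  rw [Complex.norm_exp] at h1
  exact (Real.one_lt_exp_iff.2 hz).ne' h1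

theorem Complex.sq_add_natCast_sq_ne_zero {c : ℂ} (hc : 0 < c.re) (n : ℕ) :
    c ^ 2 + (n : ℂ) ^ 2 ≠ 0 := by
  intro h
  have hx := Complex.mul_I_mem_integerComplement hc
  have h1 := integerComplement_add_ne_zero hx (n : ℤ)
  have h2 := integerComplement_add_ne_zero hx (-(n : ℤ))
  push_cast at h1 h2
  apply mul_ne_zero h1 h2
  linear_combination -h + c ^ 2 * Complex.I_sq

/-- Partial fraction expansion of the hyperbolic cotangent, in exponential form. -/
theorem Complex.hasSum_div_sq_add_sq {c : ℂ} (hc : 0 < c.re) :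
    HasSum (fun n : ℕ => c / (c ^ 2 + ((n : ℂ) + 1) ^ 2))
      (Real.pi / 2 + Real.pi * (1 / (Complex.exp (2 * Real.pi * c) - 1)) - 1 / (2 * c)) := by
  have hx := Complex.mul_I_mem_integerComplement hc
  have hc0 : c ≠ 0 := by rintro rfl; simp at hc
  have h := (summable_cotTerm hx).hasSum
  have hE1 : Complex.exp (2 * Real.pi * c) - 1 ≠ 0 := by
    apply Complex.exp_sub_one_ne_zero_of_re_pos
    have : (2 * (Real.pi : ℂ) * c).re = 2 * Real.pi * c.re := by simp
    rw [this]
    have := Real.pi_pos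
    positivity
  -- The cotangent series at ic has terms -2ic/(c² + (n+1)²); the factor i/2 turns them into the
  -- wanted ones.
  have hval : Complex.I / 2 * ∑' n, cotTerm (Complex.I * c) n =
      Real.pi / 2 + Real.pi * (1 / (Complex.exp (2 * Real.pi * c) - 1)) - 1 / (2 * c) := by
    have h1 : ∑' n, cotTerm (Complex.I * c) n = _ := (cot_series_rep' hx).symm
    rw [h1, Complex.cot_pi_eq_exp_ratio]
    have h2 : Complex.exp (2 * Real.pi * Complex.I * (Complex.I * c)) =
        (Complex.exp (2 * Real.pi * c))⁻¹ := by
      rw [← Complex.exp_neg]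
      congr 1
      linear_combination 2 * Real.pi * c * Complex.I_sq
    rw [h2]
    have hE0 := Complex.exp_ne_zero (2 * Real.pi * c)
    generalize Complex.exp (2 * Real.pi * c) = E at *
    have h3 : 1 - E⁻¹ ≠ 0 := by
      intro h
      apply hE1
      exact sub_eq_zero.2 (inv_eq_one.1 (sub_eq_zero.1 h).symm)
    have h4 : 1 - E⁻¹ = (E - 1) / E := by field_simp
    rw [h4]
    field_simp
    ring
  have := h.mul_left (Complex.I / 2)
  rw [hval] at this
  refine this.congr_fun fun n => ?_
  rw [cotTerm_identity hx]
  have h1 := Complex.sq_add_natCast_sq_ne_zero hc (n + 1)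
  push_cast at h1
  have h2 : (Complex.I * c + (n + 1)) * (Complex.I * c - (n + 1)) = -(c ^ 2 + ((n : ℂ) + 1) ^ 2) := by
    linear_combination c ^ 2 * Complex.I_sq
  rw [h2]
  field_simp
  rw [Complex.I_sq, neg_neg]

/-! ### Roots of unity, and closed forms for rows and columns. -/

/-- The points `exp (iπ(k - M)/(2M+1))`, `0 ≤ k ≤ 2M`: the roots of unity of order dividing
`4M+2` in the right half-plane. -/
noncomputable def halfPlaneRoot (M k : ℕ) : ℂ :=
  Complex.exp ((Real.pi * ((k : ℝ) - M) / (2 * M + 1) : ℝ) * Complex.I)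

theorem halfPlaneRoot_re_pos {M k : ℕ} (hk : k < 2 * M + 1) : 0 < (halfPlaneRoot M k).re := by
  rw [halfPlaneRoot, Complex.exp_ofReal_mul_I_re]
  have hk' : (k : ℝ) < 2 * M + 1 := by exact_mod_cast hk
  have hk'' : (k : ℝ) ≤ 2 * M := by exact_mod_cast Nat.lt_succ_iff.1 hk
  have hk0 : (0 : ℝ) ≤ k := k.cast_nonneg
  have hM : (0 : ℝ) ≤ M := M.cast_nonneg
  have hpi := Real.pi_pos
  apply Real.cos_pos_of_mem_Ioo
  constructor
  · rw [lt_div_iff₀ (by positivity)]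
    nlinarith
  · rw [div_lt_iff₀ (by positivity)]
    nlinarith

theorem halfPlaneRoot_pow (M k : ℕ) :
    halfPlaneRoot M k ^ (2 * M + 1) = (-1) ^ k * (-1) ^ M := by
  have hne : (2 * (M : ℂ) + 1) ≠ 0 := by exact_mod_cast Nat.succ_ne_zero (2 * M)
  rw [halfPlaneRoot, ← Complex.exp_nat_mul]
  have h : ((2 * M + 1 : ℕ) : ℂ) *
      ((Real.pi * ((k : ℝ) - M) / (2 * M + 1) : ℝ) * Complex.I) =
      k * (Real.pi * Complex.I) - M * (Real.pi * Complex.I) := by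
    push_cast
    field_simp
  rw [h, Complex.exp_sub, Complex.exp_nat_mul, Complex.exp_nat_mul, Complex.exp_pi_mul_I,
    div_eq_mul_inv, ← inv_pow, inv_neg_one]

/-- The squares of these points run once through all (2M+1)-th roots of unity. -/
theorem sum_halfPlaneRoot_pow_eq_zero {M l : ℕ} (hl : ¬ 2 * M + 1 ∣ l) :
    ∑ k ∈ Finset.range (2 * M + 1), halfPlaneRoot M k ^ (2 * l) = 0 := by
  have hne : (2 * (M : ℂ) + 1) ≠ 0 := by exact_mod_cast Nat.succ_ne_zero (2 * M)
  set ζ := Complex.exp (2 * Real.pi * Complex.I / (2 * M + 1 : ℕ)) with hζ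
  have hprim : IsPrimitiveRoot ζ (2 * M + 1) := Complex.isPrimitiveRoot_exp _ (Nat.succ_ne_zero _)
  have h (k : ℕ) : halfPlaneRoot M k ^ (2 * l) = halfPlaneRoot M 0 ^ (2 * l) * (ζ ^ l) ^ k := by
    rw [hζ, halfPlaneRoot, halfPlaneRoot, ← Complex.exp_nat_mul, ← Complex.exp_nat_mul,
      ← Complex.exp_nat_mul, ← Complex.exp_nat_mul, ← Complex.exp_add]
    congr 1
    push_cast
    field_simp
    ring
  rw [Finset.sum_congr rfl fun k _ => h k, ← Finset.mul_sum]
  have h1 : ζ ^ l ≠ 1 := fun h => hl ((hprim.pow_eq_one_iff_dvd l).1 h)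
  have h2 := geom_sum_mul (ζ ^ l) (2 * M + 1)
  rw [← pow_mul, mul_comm l, pow_mul, hprim.pow_eq_one, one_pow, sub_self] at h2
  rw [(mul_eq_zero.1 h2).resolve_right (sub_ne_zero.2 h1), mul_zero]

/-- With η_k = `halfPlaneRoot M k`, each x + (aη_k)² divides x^N + a^(2N) with a geometric sum as
quotient. As η_k^N = ±1, the weight (-1)^k aη_k is (-1)^M (aη_k)^(N+1)/a^N, so only even powers of
η_k occur and orthogonality applies. -/
theorem sum_partial_fractions {M : ℕ} {a x : ℂ} (ha : a ≠ 0)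
    (hx : ∀ k ∈ Finset.range (2 * M + 1), x + (a * halfPlaneRoot M k) ^ 2 ≠ 0)
    (hx' : x ^ (2 * M + 1) + (a ^ (2 * M + 1)) ^ 2 ≠ 0) :
    ∑ k ∈ Finset.range (2 * M + 1),
      (-1) ^ k * (a * halfPlaneRoot M k / (x + (a * halfPlaneRoot M k) ^ 2)) =
    (2 * M + 1) * a ^ (2 * M + 1) * x ^ M / (x ^ (2 * M + 1) + (a ^ (2 * M + 1)) ^ 2) := by
  set D := x ^ (2 * M + 1) + (a ^ (2 * M + 1)) ^ 2 with hD
  have hsgn (k : ℕ) : ((-1 : ℂ) ^ k) * (-1) ^ k = 1 := by rw [← mul_pow]; simp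
  have hterm : ∀ k ∈ Finset.range (2 * M + 1),
      (-1) ^ k * (a * halfPlaneRoot M k / (x + (a * halfPlaneRoot M k) ^ 2)) =
      ∑ l ∈ Finset.range (2 * M + 1), (-1) ^ M / (a ^ (2 * M + 1) * D) * (-x) ^ (2 * M - l) *
        a ^ (2 * (l + M + 1)) * halfPlaneRoot M k ^ (2 * (l + M + 1)) := by
    intro k hk
    have hgeom := geom_sum₂_mul ((a * halfPlaneRoot M k) ^ 2) (-x) (2 * M + 1)
    have hw : ((a * halfPlaneRoot M k) ^ 2) ^ (2 * M + 1) = (a ^ (2 * M + 1)) ^ 2 := by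
      rw [← pow_mul, mul_comm 2, pow_mul, mul_pow, halfPlaneRoot_pow]
      linear_combination (a ^ (2 * M + 1)) ^ 2 * ((-1) ^ M * (-1) ^ M * hsgn k + hsgn M)
    rw [hw, Odd.neg_pow ⟨M, rfl⟩, sub_neg_eq_add, sub_neg_eq_add,
      add_comm _ (x ^ _), ← hD, add_comm _ x, Nat.add_sub_cancel] at hgeom
    have hr := halfPlaneRoot_pow M k
    have hsum : ∑ l ∈ Finset.range (2 * M + 1), (-1) ^ M / (a ^ (2 * M + 1) * D) *
        (-x) ^ (2 * M - l) * a ^ (2 * (l + M + 1)) * halfPlaneRoot M k ^ (2 * (l + M + 1)) =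
        (-1) ^ M / (a ^ (2 * M + 1) * D) * (a * halfPlaneRoot M k) ^ (2 * M + 2) *
        ∑ l ∈ Finset.range (2 * M + 1), ((a * halfPlaneRoot M k) ^ 2) ^ l * (-x) ^ (2 * M - l) := by
      rw [Finset.mul_sum]
      refine Finset.sum_congr rfl fun l _ => ?_
      rw [mul_pow, mul_pow, mul_pow]
      ring
    have hpow : (a * halfPlaneRoot M k) ^ (2 * M + 2) =
        a ^ (2 * M + 1) * ((-1) ^ k * (-1) ^ M) * (a * halfPlaneRoot M k) := by
      rw [pow_succ, mul_pow, hr]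
    rw [hsum, hpow, eq_div_of_mul_eq (hx k hk) hgeom]
    have := hx k hk
    have han : a ^ (2 * M + 1) ≠ 0 := pow_ne_zero _ ha
    generalize a ^ (2 * M + 1) = A at *
    field_simp
    linear_combination -(halfPlaneRoot M k / (x + (a * halfPlaneRoot M k) ^ 2)) * hsgn M
  rw [Finset.sum_congr rfl hterm, Finset.sum_comm]
  simp_rw [← Finset.mul_sum]
  -- For 0 ≤ l ≤ 2M the only multiple of 2M+1 among the l+M+1 is the one at l = M.
  rw [Finset.sum_eq_single M]
  · have h1 : ∀ k ∈ Finset.range (2 * M + 1), halfPlaneRoot M k ^ (2 * (M + M + 1)) = 1 := by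
      intro k _
      rw [show 2 * (M + M + 1) = (2 * M + 1) * 2 by ring, pow_mul, halfPlaneRoot_pow]
      linear_combination (-1) ^ M * (-1) ^ M * hsgn k + hsgn M
    rw [Finset.sum_congr rfl h1, Finset.sum_const, Finset.card_range, nsmul_eq_mul, mul_one,
      show 2 * M - M = M by omega, show 2 * (M + M + 1) = (2 * M + 1) * 2 by ring, pow_mul,
      neg_pow x]
    have han : a ^ (2 * M + 1) ≠ 0 := pow_ne_zero _ ha
    generalize a ^ (2 * M + 1) = A at *
    push_cast
    field_simp
    linear_combination x ^ M * (2 * M + 1) * hsgn M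
  · intro l hl hlM
    rw [sum_halfPlaneRoot_pow_eq_zero, mul_zero]
    rintro ⟨q, hq⟩
    have hl' := Finset.mem_range.1 hl
    have hq1 : 0 < q := Nat.pos_of_ne_zero (by rintro rfl; omega)
    have hq2 : q < 2 := by
      by_contra h
      have : (2 * M + 1) * 2 ≤ (2 * M + 1) * q := Nat.mul_le_mul_left _ (by omega)
      omega
    obtain rfl : q = 1 := by omega
    omega
  · intro h
    exact absurd (Finset.mem_range.2 (by omega)) h

/-- This removes the 1/(2c) terms of the coth expansion: (-1)^k/η_k = (-1)^M η_k^(2M), and 2M+1 does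
not divide M when M > 0, so N > 1 is essential. -/
theorem sum_neg_one_pow_div_halfPlaneRoot {M : ℕ} (hM : 0 < M) (a : ℂ) :
    ∑ k ∈ Finset.range (2 * M + 1), (-1) ^ k * (1 / (2 * (a * halfPlaneRoot M k))) = 0 := by
  have h : ∀ k ∈ Finset.range (2 * M + 1), (-1) ^ k * (1 / (2 * (a * halfPlaneRoot M k))) =
      (-1) ^ M / (2 * a) * halfPlaneRoot M k ^ (2 * M) := by
    intro k _
    have h0 : halfPlaneRoot M k ≠ 0 := Complex.exp_ne_zero _
    have hr := halfPlaneRoot_pow M k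
    rw [pow_succ] at hr
    have hs : ((-1 : ℂ) ^ M) * (-1) ^ M = 1 := by rw [← mul_pow]; simp
    rcases eq_or_ne a 0 with rfl | ha
    · simp
    field_simp
    linear_combination -(-1) ^ M * hr - (-1) ^ k * hs
  rw [Finset.sum_congr rfl h, ← Finset.mul_sum, sum_halfPlaneRoot_pow_eq_zero, mul_zero]
  intro hd
  have := Nat.le_of_dvd hM hd
  omega

/-- The coth expansions at c = aη_k are combined with weights (-1)^k, whose sum is 1 because there
are oddly many. -/
theorem hasSum_pow_div_column {M : ℕ} (hM : 0 < M) {a : ℝ} (ha : 0 < a) :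
    HasSum (fun n : ℕ => ((n : ℝ) + 1) ^ (2 * M) /
        (((n : ℝ) + 1) ^ (2 * (2 * M + 1)) + (a ^ (2 * M + 1)) ^ 2))
      (Real.pi / ((2 * M + 1) * a ^ (2 * M + 1)) * (1 / 2 + ∑ k ∈ Finset.range (2 * M + 1),
        (-1) ^ k * (1 / (Complex.exp (2 * Real.pi * (a * halfPlaneRoot M k)) - 1)).re)) := by
  have hre : ∀ k ∈ Finset.range (2 * M + 1), 0 < ((a : ℂ) * halfPlaneRoot M k).re := by
    intro k hk
    rw [Complex.re_ofReal_mul]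
    exact mul_pos ha (halfPlaneRoot_re_pos (Finset.mem_range.1 hk))
  have h1 := hasSum_sum fun k hk =>
    (Complex.hasSum_div_sq_add_sq (hre k hk)).mul_left ((-1 : ℂ) ^ k)
  have hval : ∑ k ∈ Finset.range (2 * M + 1), (-1 : ℂ) ^ k * (Real.pi / 2 + Real.pi *
      (1 / (Complex.exp (2 * Real.pi * (a * halfPlaneRoot M k)) - 1)) -
        1 / (2 * (a * halfPlaneRoot M k))) =
      Real.pi * (1 / 2 + ∑ k ∈ Finset.range (2 * M + 1), (-1) ^ k *
        (1 / (Complex.exp (2 * Real.pi * (a * halfPlaneRoot M k)) - 1))) := by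
    simp_rw [mul_sub, mul_add, Finset.sum_sub_distrib, Finset.sum_add_distrib]
    rw [sum_neg_one_pow_div_halfPlaneRoot hM, ← Finset.sum_mul, neg_one_geom_sum,
      if_neg (by simp), Finset.mul_sum]
    simp_rw [mul_left_comm]
    ring
  rw [hval] at h1
  have h2 := Complex.hasSum_re (h1.mul_left (1 / ((2 * M + 1) * (a : ℂ) ^ (2 * M + 1))))
  have hNa : (2 * (M : ℂ) + 1) * (a : ℂ) ^ (2 * M + 1) ≠ 0 := by
    exact_mod_cast (by positivity : (2 * (M : ℝ) + 1) * a ^ (2 * M + 1) ≠ 0)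
  convert h2 using 1
  · ext n
    have hne : ((n : ℂ) + 1) ^ 2 ≠ 0 := by exact_mod_cast (by positivity : (n + 1) ^ 2 ≠ 0)
    have hpf := sum_partial_fractions (M := M) (a := a) (x := ((n : ℂ) + 1) ^ 2)
      (by exact_mod_cast ha.ne') (fun k hk => by
        have := Complex.sq_add_natCast_sq_ne_zero (hre k hk) (n + 1)
        push_cast at this
        rwa [add_comm]) (by
        exact_mod_cast (by positivity : ((((n : ℝ) + 1) ^ 2) ^ (2 * M + 1) + (a ^ (2 * M + 1)) ^ 2) ≠ 0))
    simp_rw [add_comm (((n : ℂ) + 1) ^ 2)] at hpf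
    rw [hpf]
    have : (1 / ((2 * M + 1) * (a : ℂ) ^ (2 * M + 1)) * ((2 * M + 1) * (a : ℂ) ^ (2 * M + 1) *
        (((n : ℂ) + 1) ^ 2) ^ M / ((((n : ℂ) + 1) ^ 2) ^ (2 * M + 1) + ((a : ℂ) ^ (2 * M + 1)) ^ 2)))
        = ((((n : ℝ) + 1) ^ (2 * M) /
        (((n : ℝ) + 1) ^ (2 * (2 * M + 1)) + (a ^ (2 * M + 1)) ^ 2) : ℝ) : ℂ) := by
      push_cast
      rw [pow_mul, pow_mul, ← mul_div_assoc, ← mul_assoc, one_div_mul_cancel hNa, one_mul]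
    rw [this, Complex.ofReal_re]
  · have : (1 / ((2 * M + 1) * (a : ℂ) ^ (2 * M + 1)) * Real.pi : ℂ) =
        ((Real.pi / ((2 * M + 1) * a ^ (2 * M + 1)) : ℝ) : ℂ) := by
      push_cast
      ring
    rw [← mul_assoc, this, Complex.re_ofReal_mul, Complex.add_re, Complex.re_sum]
    congr 2
    · norm_num
    · refine Finset.sum_congr rfl fun k _ => ?_
      have : ((-1 : ℂ) ^ k) = (((-1) ^ k : ℝ) : ℂ) := by push_cast; rfl
      rw [this, Complex.re_ofReal_mul]

/-- The coth expansion at c = (n+1)^(2M+1), divided by n+1. -/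
theorem hasSum_pow_div_row (n M : ℕ) :
    HasSum (fun m : ℕ => ((n : ℝ) + 1) ^ (2 * M) /
        (((n : ℝ) + 1) ^ (2 * (2 * M + 1)) + ((m : ℝ) + 1) ^ 2))
      (1 / ((n : ℝ) + 1) * (Real.pi / 2 +
        Real.pi * (1 / (Real.exp (2 * Real.pi * ((n : ℝ) + 1) ^ (2 * M + 1)) - 1)) -
        1 / (2 * ((n : ℝ) + 1) ^ (2 * M + 1)))) := by
  have hn : (0 : ℝ) < (n : ℝ) + 1 := by positivity
  have h := Complex.hasSum_div_sq_add_sq (c := ((((n : ℝ) + 1) ^ (2 * M + 1) : ℝ) : ℂ))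
    (by rw [Complex.ofReal_re]; positivity)
  have h1 : HasSum (fun m : ℕ => ((n : ℝ) + 1) ^ (2 * M + 1) /
      ((((n : ℝ) + 1) ^ (2 * M + 1)) ^ 2 + ((m : ℝ) + 1) ^ 2)) (Real.pi / 2 +
        Real.pi * (1 / (Real.exp (2 * Real.pi * ((n : ℝ) + 1) ^ (2 * M + 1)) - 1)) -
        1 / (2 * ((n : ℝ) + 1) ^ (2 * M + 1))) := by
    rw [← Complex.hasSum_ofReal]
    push_cast at h ⊢
    exact h
  refine (h1.mul_left (1 / ((n : ℝ) + 1))).congr_fun fun m => ?_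
  rw [pow_succ _ (2 * M), ← pow_succ, ← pow_mul, mul_comm (2 * M + 1) 2]
  field_simp
  ring

/-! ### Tails of rows and columns as Riemann sums. -/

/-- Integral-test bounds for the tail of a series, in terms of an antiderivative. -/
theorem HasSum.bounds_of_antitoneOn {F h : ℝ → ℝ} {Q s : ℝ}
    (hder : ∀ x, Q ≤ x → HasDerivAt h (-F x) x) (hanti : AntitoneOn F (Set.Ici Q))
    (hlim : Filter.Tendsto h Filter.atTop (nhds 0))
    (hs : HasSum (fun k : ℕ => F (Q + k + 1)) s) : h Q - F Q ≤ s ∧ s ≤ h Q := by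
  have hstep (k : ℕ) : F (Q + k + 1) ≤ h (Q + k) - h (Q + k + 1) ∧
      h (Q + k) - h (Q + k + 1) ≤ F (Q + k) := by
    have hk : Q ≤ Q + k := by simp
    obtain ⟨c, hc, hc'⟩ := exists_hasDerivAt_eq_slope h (fun x => -F x)
      (show Q + k < Q + k + 1 by simp)
      (fun x hx => (hder x (hk.trans hx.1)).continuousAt.continuousWithinAt)
      (fun x hx => hder x (hk.trans hx.1.le))
    have h1 : h (Q + k) - h (Q + k + 1) = F c := by
      rw [add_sub_cancel_left, div_one] at hc'
      linarith
    rw [h1]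
    exact ⟨hanti (hk.trans hc.1.le) (hk.trans (by simp)) hc.2.le,
      hanti hk (hk.trans hc.1.le) hc.1.le⟩
  have htel (n : ℕ) : ∑ k ∈ Finset.range n, (h (Q + k) - h (Q + k + 1)) = h Q - h (Q + n) := by
    have := Finset.sum_range_sub' (fun k : ℕ => h (Q + k)) n
    simp only [Nat.cast_add, Nat.cast_one, Nat.cast_zero, add_zero, ← add_assoc] at this
    exact this
  have hcast : Filter.Tendsto (fun n : ℕ => h Q - h (Q + n)) Filter.atTop (nhds (h Q)) := by
    have := (hlim.comp (Filter.tendsto_atTop_add_const_left _ Q tendsto_natCast_atTop_atTop)).const_sub (h Q)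
    rwa [sub_zero] at this
  refine ⟨?_, ?_⟩
  · have hs' : HasSum (fun k : ℕ => F (Q + k)) (s + F Q) := by
      rw [← hasSum_nat_add_iff' 1]
      simpa [add_assoc] using hs
    have : h Q ≤ s + F Q := le_of_tendsto_of_tendsto' hcast hs'.tendsto_sum_nat fun n => by
      rw [← htel]
      exact Finset.sum_le_sum fun k _ => (hstep k).2
    linarith
  · exact le_of_tendsto_of_tendsto' hs.tendsto_sum_nat hcast fun n => by
      rw [← htel]
      exact Finset.sum_le_sum fun k _ => (hstep k).1

theorem tendsto_riemannSum {f : ℝ → ℝ} (hf : Continuous f) :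
    Filter.Tendsto (fun n : ℕ => (1 / (n : ℝ)) * ∑ k ∈ Finset.range n, f (((k : ℝ) + 1) / n))
      Filter.atTop (nhds (∫ x in (0 : ℝ)..1, f x)) := by
  rw [Metric.tendsto_atTop]
  intro ε hε
  have hu := isCompact_Icc.uniformContinuousOn_of_continuous (s := Set.Icc (0 : ℝ) 1) hf.continuousOn
  rw [Metric.uniformContinuousOn_iff] at hu
  obtain ⟨δ, hδ, hfδ⟩ := hu (ε / 2) (by positivity)
  obtain ⟨n₀, hn₀⟩ := exists_nat_gt (1 / δ)
  refine ⟨n₀ + 1, fun n hn => ?_⟩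
  have hn0 : (0 : ℝ) < n := by exact_mod_cast (by omega : 0 < n)
  have hnδ : 1 / (n : ℝ) < δ := by
    rw [div_lt_comm₀ hn0 hδ]
    exact hn₀.trans_le (by exact_mod_cast (by omega : n₀ ≤ n))
  have hsplit : ∫ x in (0 : ℝ)..1, f x =
      ∑ k ∈ Finset.range n, ∫ x in ((k : ℝ) / n)..(((k : ℝ) + 1) / n), f x := by
    have := intervalIntegral.sum_integral_adjacent_intervals (μ := MeasureTheory.volume) (f := f)
      (a := fun k : ℕ => (k : ℝ) / n) (n := n) fun k _ => hf.intervalIntegrable _ _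
    simp only [Nat.cast_add, Nat.cast_one, Nat.cast_zero, zero_div, div_self hn0.ne'] at this
    exact this.symm
  rw [Real.dist_eq, hsplit, Finset.mul_sum, ← Finset.sum_sub_distrib]
  have hterm : ∀ k ∈ Finset.range n, |1 / (n : ℝ) * f (((k : ℝ) + 1) / n) -
      ∫ x in ((k : ℝ) / n)..(((k : ℝ) + 1) / n), f x| ≤ ε / 2 * (1 / n) := by
    intro k hk
    have hk1 : (k : ℝ) + 1 ≤ n := by exact_mod_cast Finset.mem_range.1 hk
    have hlen : ((k : ℝ) + 1) / n - k / n = 1 / n := by ring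
    have hle : (k : ℝ) / n ≤ ((k : ℝ) + 1) / n := by gcongr; simp
    have h1 : 1 / (n : ℝ) * f (((k : ℝ) + 1) / n) =
        ∫ _ in ((k : ℝ) / n)..(((k : ℝ) + 1) / n), f (((k : ℝ) + 1) / n) := by
      rw [intervalIntegral.integral_const, hlen, smul_eq_mul]
    rw [h1, ← intervalIntegral.integral_sub (by simp) (hf.intervalIntegrable _ _), ← Real.norm_eq_abs]
    refine (intervalIntegral.norm_integral_le_of_norm_le_const (C := ε / 2) fun x hx => ?_).trans ?_
    · rw [Set.uIoc_of_le hle] at hx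
      have hup : ((k : ℝ) + 1) / n ≤ 1 := (div_le_one hn0).2 hk1
      have hlow : 0 ≤ (k : ℝ) / n := by positivity
      refine (hfδ _ ⟨hlow.trans hle, hup⟩ _ ⟨hlow.trans hx.1.le, hx.2.trans hup⟩ ?_).le
      rw [Real.dist_eq, abs_of_nonneg (by linarith [hx.2])]
      linarith [hx.1]
    · rw [hlen, abs_of_pos (by positivity)]
  calc |_| ≤ ∑ k ∈ Finset.range n, ε / 2 * (1 / n) :=
        (Finset.abs_sum_le_sum_abs _ _).trans (Finset.sum_le_sum hterm)
    _ = ε / 2 := by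
        rw [Finset.sum_const, Finset.card_range, nsmul_eq_mul]
        field_simp
    _ < ε := by linarith

/-- The continuous function `arctan x / x`. -/
noncomputable def arctanDiv : ℝ → ℝ := dslope Real.arctan 0

theorem continuous_arctanDiv : Continuous arctanDiv := by
  rw [arctanDiv, ← continuousOn_univ, continuousOn_dslope Filter.univ_mem]
  exact ⟨Real.continuous_arctan.continuousOn, Real.differentiable_arctan 0⟩

theorem mul_arctanDiv (x : ℝ) : x * arctanDiv x = Real.arctan x := by
  have := sub_smul_dslope Real.arctan 0 x
  simpa [arctanDiv] using this

/-- The substitution y = x^(K+1); it makes the limit of the row tails agree with that of the column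
tails. -/
theorem integral_pow_mul_arctanDiv (K : ℕ) :
    ∫ x in (0 : ℝ)..1, x ^ K * arctanDiv (x ^ (K + 1)) =
      1 / ((K : ℝ) + 1) * ∫ x in (0 : ℝ)..1, arctanDiv x := by
  have h := intervalIntegral.integral_comp_mul_deriv (a := 0) (b := 1) (f := fun x : ℝ => x ^ (K + 1))
    (f' := fun x : ℝ => ((K : ℝ) + 1) * x ^ K) (g := arctanDiv)
    (fun x _ => by simpa using hasDerivAt_pow (K + 1) x) (by fun_prop) continuous_arctanDiv
  simp only [Function.comp_apply, one_pow, zero_pow K.succ_ne_zero] at h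
  rw [← h, ← intervalIntegral.integral_const_mul]
  refine intervalIntegral.integral_congr fun x _ => ?_
  have : (K : ℝ) + 1 ≠ 0 := by positivity
  field_simp

theorem row_tail_bounds {u Q s : ℝ} (hu : 0 < u) (hQ : 0 < Q)
    (hs : HasSum (fun m : ℕ => 1 / (u ^ 2 + (Q + m + 1) ^ 2)) s) :
    1 / u * Real.arctan (u / Q) - 1 / (u ^ 2 + Q ^ 2) ≤ s ∧ s ≤ 1 / u * Real.arctan (u / Q) := by
  refine HasSum.bounds_of_antitoneOn (F := fun x => 1 / (u ^ 2 + x ^ 2))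
    (h := fun x => 1 / u * Real.arctan (u / x)) ?_ ?_ ?_ hs
  · intro x hx
    have hx0 : 0 < x := hQ.trans_le hx
    have h1 := (((hasDerivAt_const x u).fun_div (hasDerivAt_id' x) hx0.ne').arctan).const_mul (1 / u)
    refine h1.congr_deriv ?_
    field_simp
    ring
  · intro x hx y hy hxy
    have hx0 : 0 < x := hQ.trans_le hx
    dsimp only
    gcongr
  · have h1 : Filter.Tendsto (fun x : ℝ => u / x) Filter.atTop (nhds 0) :=
      Filter.Tendsto.const_div_atTop Filter.tendsto_id u
    have h2 := ((Real.continuous_arctan.tendsto 0).comp h1).const_mul (1 / u)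
    simpa using h2

/-- For M > 0 the summand rises before it falls; `hmP` places the whole tail where it falls. -/
theorem column_tail_bounds {M : ℕ} {m P s : ℝ} (hm : 0 < m) (hP : 0 < P) (hmP : m ≤ P ^ (2 * M + 1))
    (hs : HasSum (fun n : ℕ => (P + n + 1) ^ (2 * M) /
      ((P + n + 1) ^ (2 * (2 * M + 1)) + m ^ 2)) s) :
    1 / ((2 * M + 1) * m) * Real.arctan (m / P ^ (2 * M + 1)) -
      P ^ (2 * M) / (P ^ (2 * (2 * M + 1)) + m ^ 2) ≤ s ∧
    s ≤ 1 / ((2 * M + 1) * m) * Real.arctan (m / P ^ (2 * M + 1)) := by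
  refine HasSum.bounds_of_antitoneOn
    (F := fun x => x ^ (2 * M) / (x ^ (2 * (2 * M + 1)) + m ^ 2))
    (h := fun x => 1 / ((2 * M + 1) * m) * Real.arctan (m / x ^ (2 * M + 1))) ?_ ?_ ?_ hs
  · intro x hx
    have hx0 : 0 < x := hP.trans_le hx
    have hpw : 0 < x ^ (2 * M + 1) := by positivity
    have h1 := (((hasDerivAt_const x m).fun_div (hasDerivAt_pow (2 * M + 1) x) hpw.ne').arctan).const_mul
      (1 / ((2 * M + 1) * m))
    refine h1.congr_deriv ?_
    have h2 : x ^ (2 * (2 * M + 1)) = (x ^ (2 * M + 1)) ^ 2 := by rw [mul_comm, pow_mul]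
    have hM : (2 * (M : ℝ) + 1) ≠ 0 := by positivity
    rw [h2]
    push_cast
    field_simp
    ring
  · intro x hx y hy hxy
    have hx0 : 0 < x := hP.trans_le hx
    have hy0 : 0 < y := hP.trans_le hy
    have hmx : m ≤ x ^ (2 * M + 1) := hmP.trans (by gcongr; exact hx)
    dsimp only
    rw [div_le_div_iff₀ (by positivity) (by positivity)]
    have e (z : ℝ) : z ^ (2 * (2 * M + 1)) = (z ^ (2 * M)) ^ 2 * z ^ 2 := by ring
    have hm2 : m ^ 2 ≤ (x ^ (2 * M)) ^ 2 * x ^ 2 := by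
      rw [← e, mul_comm 2, pow_mul]
      gcongr
    have hAB : x ^ (2 * M) ≤ y ^ (2 * M) := by gcongr
    have hpq : x ^ 2 ≤ y ^ 2 := by gcongr
    have hA : 0 < x ^ (2 * M) := by positivity
    have hp : 0 < x ^ 2 := by positivity
    rw [e, e]
    generalize x ^ (2 * M) = A at *
    generalize y ^ (2 * M) = B at *
    generalize x ^ 2 = p at *
    generalize y ^ 2 = q at *
    -- The cross-multiplied inequality then follows from 2AB - A² ≤ B² and p ≤ q.
    have h1 : (B - A) * m ^ 2 ≤ (B - A) * (A ^ 2 * p) :=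
      mul_le_mul_of_nonneg_left hm2 (by linarith)
    have h2 : A * B ^ 2 * p ≤ A * B ^ 2 * q := by gcongr
    have h3 : 0 ≤ A * p * (B - A) * (B - A) :=
      mul_nonneg (mul_nonneg (by positivity) (by linarith)) (by linarith)
    linarith
  · have h1 : Filter.Tendsto (fun x : ℝ => m / x ^ (2 * M + 1)) Filter.atTop (nhds 0) :=
      Filter.Tendsto.const_div_atTop (Filter.tendsto_pow_atTop (by omega)) m
    have h2 := ((Real.continuous_arctan.tendsto 0).comp h1).const_mul (1 / ((2 * M + 1) * m))
    simpa using h2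

/-- With x = n+1, the tail is (1/x)·arctan((x/P)^N) up to 1/P², a Riemann term of mesh 1/P; the P
errors total at most 1/P. -/
theorem tendsto_sum_row_tails {M : ℕ} {R : ℕ → ℝ}
    (hR : ∀ n : ℕ, HasSum (fun m : ℕ => ((n : ℝ) + 1) ^ (2 * M) /
      (((n : ℝ) + 1) ^ (2 * (2 * M + 1)) + ((m : ℝ) + 1) ^ 2)) (R n)) :
    Filter.Tendsto (fun P : ℕ => ∑ n ∈ Finset.range P, (R n -
      ∑ m ∈ Finset.range (P ^ (2 * M + 1)), ((n : ℝ) + 1) ^ (2 * M) /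
        (((n : ℝ) + 1) ^ (2 * (2 * M + 1)) + ((m : ℝ) + 1) ^ 2)))
      Filter.atTop (nhds (1 / (2 * M + 1) * ∫ x in (0 : ℝ)..1, arctanDiv x)) := by
  have hmain := tendsto_riemannSum (f := fun x => x ^ (2 * M) * arctanDiv (x ^ (2 * M + 1)))
    (by have := continuous_arctanDiv; fun_prop)
  rw [integral_pow_mul_arctanDiv] at hmain
  push_cast at hmain
  have hlow := hmain.sub tendsto_one_div_atTop_nhds_zero_nat
  rw [sub_zero] at hlow
  have hbd : ∀ P : ℕ, 0 < P → ∀ n ∈ Finset.range P,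
      1 / (P : ℝ) * ((((n : ℝ) + 1) / P) ^ (2 * M) * arctanDiv ((((n : ℝ) + 1) / P) ^ (2 * M + 1)))
        - 1 / (P : ℝ) * (1 / P) ≤
      R n - ∑ m ∈ Finset.range (P ^ (2 * M + 1)), ((n : ℝ) + 1) ^ (2 * M) /
        (((n : ℝ) + 1) ^ (2 * (2 * M + 1)) + ((m : ℝ) + 1) ^ 2) ∧
      R n - ∑ m ∈ Finset.range (P ^ (2 * M + 1)), ((n : ℝ) + 1) ^ (2 * M) /
        (((n : ℝ) + 1) ^ (2 * (2 * M + 1)) + ((m : ℝ) + 1) ^ 2) ≤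
      1 / (P : ℝ) * ((((n : ℝ) + 1) / P) ^ (2 * M) *
        arctanDiv ((((n : ℝ) + 1) / P) ^ (2 * M + 1))) := by
    intro P hP n hn
    have hP0 : (0 : ℝ) < P := by exact_mod_cast hP
    have hP1 : (1 : ℝ) ≤ P := by exact_mod_cast hP
    have hx : (0 : ℝ) < (n : ℝ) + 1 := by positivity
    have hxP : (n : ℝ) + 1 ≤ P := by exact_mod_cast Finset.mem_range.1 hn
    have ht := (hasSum_nat_add_iff' (P ^ (2 * M + 1))).2 (hR n)
    set t := R n - ∑ m ∈ Finset.range (P ^ (2 * M + 1)), ((n : ℝ) + 1) ^ (2 * M) /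
        (((n : ℝ) + 1) ^ (2 * (2 * M + 1)) + ((m : ℝ) + 1) ^ 2)
    set x : ℝ := (n : ℝ) + 1
    have hs : HasSum (fun m : ℕ => 1 / ((x ^ (2 * M + 1)) ^ 2 + ((P : ℝ) ^ (2 * M + 1) + m + 1) ^ 2))
        (1 / x ^ (2 * M) * t) := by
      refine (ht.mul_left (1 / x ^ (2 * M))).congr_fun fun m => ?_
      push_cast
      rw [mul_comm 2 (2 * M + 1), pow_mul x, add_comm (m : ℝ)]
      field_simp
      ring
    obtain ⟨h1, h2⟩ := row_tail_bounds (by positivity) (by positivity) hs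
    have hmain_eq : x ^ (2 * M) * (1 / x ^ (2 * M + 1) *
        Real.arctan (x ^ (2 * M + 1) / (P : ℝ) ^ (2 * M + 1))) =
        1 / (P : ℝ) * ((x / P) ^ (2 * M) * arctanDiv ((x / P) ^ (2 * M + 1))) := by
      rw [← div_pow, ← mul_arctanDiv, div_pow, div_pow, pow_succ x, pow_succ (P : ℝ)]
      field_simp
    have ht_eq : x ^ (2 * M) * (1 / x ^ (2 * M) * t) = t := by field_simp
    have hpos : 0 < x ^ (2 * M) := by positivity
    have herr : x ^ (2 * M) * (1 / ((x ^ (2 * M + 1)) ^ 2 + ((P : ℝ) ^ (2 * M + 1)) ^ 2)) ≤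
        1 / (P : ℝ) * (1 / P) := by
      rw [mul_one_div, div_mul_div_comm, one_mul, div_le_div_iff₀ (by positivity) (by positivity)]
      have : x ^ (2 * M) ≤ (P : ℝ) ^ (2 * M) := by gcongr
      calc x ^ (2 * M) * (P * P) ≤ (P : ℝ) ^ (2 * M) * (P * P) := by gcongr
        _ = (P : ℝ) ^ (2 * M + 2) := by ring
        _ ≤ (P : ℝ) ^ ((2 * M + 1) * 2) := pow_le_pow_right₀ hP1 (by omega)
        _ = ((P : ℝ) ^ (2 * M + 1)) ^ 2 := pow_mul _ _ _
        _ ≤ 1 * ((x ^ (2 * M + 1)) ^ 2 + ((P : ℝ) ^ (2 * M + 1)) ^ 2) := by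
          have : 0 ≤ (x ^ (2 * M + 1)) ^ 2 := by positivity
          linarith
    have h1' := mul_le_mul_of_nonneg_left h1 hpos.le
    have h2' := mul_le_mul_of_nonneg_left h2 hpos.le
    rw [ht_eq, hmain_eq] at h2'
    rw [ht_eq, mul_sub, hmain_eq] at h1'
    exact ⟨by linarith, h2'⟩
  refine tendsto_of_tendsto_of_tendsto_of_le_of_le' hlow hmain ?_ ?_
  · filter_upwards [Filter.eventually_gt_atTop 0] with P hP
    have := Finset.sum_le_sum fun n hn => (hbd P hP n hn).1
    refine le_trans (le_of_eq ?_) this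
    have hP0 : (P : ℝ) ≠ 0 := by exact_mod_cast hP.ne'
    rw [Finset.sum_sub_distrib, ← Finset.mul_sum, Finset.sum_const, Finset.card_range, nsmul_eq_mul]
    field_simp
  · filter_upwards [Filter.eventually_gt_atTop 0] with P hP
    rw [Finset.mul_sum]
    exact Finset.sum_le_sum fun n hn => (hbd P hP n hn).2

/-- With y = m+1, the tail is arctan(y/P^N)/(Ny) up to P^(-N-1), a Riemann term of mesh P^(-N); the
P^N errors total at most 1/P. -/
theorem tendsto_sum_column_tails {M : ℕ} {C : ℕ → ℝ}
    (hC : ∀ m : ℕ, HasSum (fun n : ℕ => ((n : ℝ) + 1) ^ (2 * M) /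
      (((n : ℝ) + 1) ^ (2 * (2 * M + 1)) + ((m : ℝ) + 1) ^ 2)) (C m)) :
    Filter.Tendsto (fun P : ℕ => ∑ m ∈ Finset.range (P ^ (2 * M + 1)), (C m -
      ∑ n ∈ Finset.range P, ((n : ℝ) + 1) ^ (2 * M) /
        (((n : ℝ) + 1) ^ (2 * (2 * M + 1)) + ((m : ℝ) + 1) ^ 2)))
      Filter.atTop (nhds (1 / (2 * M + 1) * ∫ x in (0 : ℝ)..1, arctanDiv x)) := by
  have hmain := ((tendsto_riemannSum continuous_arctanDiv).comp
    (Filter.tendsto_pow_atTop (α := ℕ) (n := 2 * M + 1) (by omega))).const_mul (1 / (2 * (M : ℝ) + 1))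
  have hlow := hmain.sub tendsto_one_div_atTop_nhds_zero_nat
  rw [sub_zero] at hlow
  have hbd : ∀ P : ℕ, 0 < P → ∀ m ∈ Finset.range (P ^ (2 * M + 1)),
      1 / (2 * (M : ℝ) + 1) * (1 / (P : ℝ) ^ (2 * M + 1) *
        arctanDiv (((m : ℝ) + 1) / (P : ℝ) ^ (2 * M + 1))) -
        1 / (P : ℝ) ^ (2 * M + 1) * (1 / P) ≤
      C m - ∑ n ∈ Finset.range P, ((n : ℝ) + 1) ^ (2 * M) /
        (((n : ℝ) + 1) ^ (2 * (2 * M + 1)) + ((m : ℝ) + 1) ^ 2) ∧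
      C m - ∑ n ∈ Finset.range P, ((n : ℝ) + 1) ^ (2 * M) /
        (((n : ℝ) + 1) ^ (2 * (2 * M + 1)) + ((m : ℝ) + 1) ^ 2) ≤
      1 / (2 * (M : ℝ) + 1) * (1 / (P : ℝ) ^ (2 * M + 1) *
        arctanDiv (((m : ℝ) + 1) / (P : ℝ) ^ (2 * M + 1))) := by
    intro P hP m hm
    have hP0 : (0 : ℝ) < P := by exact_mod_cast hP
    have hy : (0 : ℝ) < (m : ℝ) + 1 := by positivity
    have hyP : (m : ℝ) + 1 ≤ (P : ℝ) ^ (2 * M + 1) := by exact_mod_cast Finset.mem_range.1 hm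
    have ht := (hasSum_nat_add_iff' P).2 (hC m)
    set t := C m - ∑ n ∈ Finset.range P, ((n : ℝ) + 1) ^ (2 * M) /
        (((n : ℝ) + 1) ^ (2 * (2 * M + 1)) + ((m : ℝ) + 1) ^ 2)
    set y : ℝ := (m : ℝ) + 1
    have hs : HasSum (fun n : ℕ => ((P : ℝ) + n + 1) ^ (2 * M) /
        (((P : ℝ) + n + 1) ^ (2 * (2 * M + 1)) + y ^ 2)) t := by
      refine ht.congr_fun fun n => ?_
      push_cast
      rw [add_comm (n : ℝ)]
    obtain ⟨h1, h2⟩ := column_tail_bounds hy hP0 hyP hs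
    have hmain_eq : 1 / ((2 * (M : ℝ) + 1) * y) * Real.arctan (y / (P : ℝ) ^ (2 * M + 1)) =
        1 / (2 * (M : ℝ) + 1) * (1 / (P : ℝ) ^ (2 * M + 1) *
        arctanDiv (y / (P : ℝ) ^ (2 * M + 1))) := by
      rw [← mul_arctanDiv]
      field_simp
    have herr : (P : ℝ) ^ (2 * M) / ((P : ℝ) ^ (2 * (2 * M + 1)) + y ^ 2) ≤
        1 / (P : ℝ) ^ (2 * M + 1) * (1 / P) := by
      rw [div_mul_div_comm, one_mul, div_le_div_iff₀ (by positivity) (by positivity)]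
      calc (P : ℝ) ^ (2 * M) * ((P : ℝ) ^ (2 * M + 1) * P) = (P : ℝ) ^ (2 * (2 * M + 1)) := by ring
        _ ≤ 1 * ((P : ℝ) ^ (2 * (2 * M + 1)) + y ^ 2) := by
          have : 0 ≤ y ^ 2 := by positivity
          linarith
    rw [hmain_eq] at h1 h2
    exact ⟨by linarith, h2⟩
  refine tendsto_of_tendsto_of_tendsto_of_le_of_le' hlow hmain ?_ ?_
  · filter_upwards [Filter.eventually_gt_atTop 0] with P hP
    have := Finset.sum_le_sum fun n hn => (hbd P hP n hn).1
    refine le_trans (le_of_eq ?_) this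
    have hP0 : (P : ℝ) ≠ 0 := by exact_mod_cast hP.ne'
    rw [Finset.sum_sub_distrib, ← Finset.mul_sum, ← Finset.mul_sum, Finset.sum_const,
      Finset.card_range, nsmul_eq_mul]
    simp only [Function.comp_apply]
    push_cast
    field_simp
  · filter_upwards [Filter.eventually_gt_atTop 0] with P hP
    have := Finset.sum_le_sum fun n hn => (hbd P hP n hn).2
    refine this.trans (le_of_eq ?_)
    rw [← Finset.mul_sum, ← Finset.mul_sum]
    simp only [Function.comp_apply]
    push_cast
    rfl

/-- Rows and columns share the P × P^N rectangle, so only the tails differ, and their limits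
coincide. -/
theorem tendsto_sum_rows_sub_sum_columns {M : ℕ} {R C : ℕ → ℝ}
    (hR : ∀ n : ℕ, HasSum (fun m : ℕ => ((n : ℝ) + 1) ^ (2 * M) /
      (((n : ℝ) + 1) ^ (2 * (2 * M + 1)) + ((m : ℝ) + 1) ^ 2)) (R n))
    (hC : ∀ m : ℕ, HasSum (fun n : ℕ => ((n : ℝ) + 1) ^ (2 * M) /
      (((n : ℝ) + 1) ^ (2 * (2 * M + 1)) + ((m : ℝ) + 1) ^ 2)) (C m)) :
    Filter.Tendsto (fun P : ℕ => ∑ n ∈ Finset.range P, R n -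
      ∑ m ∈ Finset.range (P ^ (2 * M + 1)), C m) Filter.atTop (nhds 0) := by
  have h := (tendsto_sum_row_tails hR).sub (tendsto_sum_column_tails hC)
  rw [sub_self] at h
  refine h.congr fun P => ?_
  rw [Finset.sum_sub_distrib, Finset.sum_sub_distrib, Finset.sum_comm]
  ring

/-! ### Convergence of the two kinds of series. -/

theorem Real.pow_div_factorial_le_exp_sub_one {x : ℝ} (hx : 0 ≤ x) {K : ℕ} (hK : 0 < K) :
    x ^ K / K.factorial ≤ Real.exp x - 1 := by
  have h := Real.sum_le_exp_of_nonneg hx (K + 1)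
  rw [Finset.sum_range_succ] at h
  have h1 : 1 ≤ ∑ i ∈ Finset.range K, x ^ i / i.factorial := by
    have := Finset.single_le_sum (f := fun i => x ^ i / (i.factorial : ℝ)) (s := Finset.range K)
      (fun i _ => by positivity) (Finset.mem_range.2 hK)
    simpa using this
  linarith

theorem Complex.abs_re_one_div_exp_sub_one_le {z : ℂ} (hz : 0 < z.re) {K : ℕ} (hK : 0 < K) :
    |(1 / (Complex.exp z - 1)).re| ≤ K.factorial / z.re ^ K := by
  have h1 := Real.pow_div_factorial_le_exp_sub_one hz.le hK
  have h2 : Real.exp z.re - 1 ≤ ‖Complex.exp z - 1‖ := by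
    have := norm_sub_norm_le (Complex.exp z) 1
    rwa [Complex.norm_exp, norm_one] at this
  have h3 : 0 < z.re ^ K / K.factorial := by positivity
  calc |(1 / (Complex.exp z - 1)).re| ≤ ‖1 / (Complex.exp z - 1)‖ := Complex.abs_re_le_norm _
    _ = 1 / ‖Complex.exp z - 1‖ := by rw [norm_div, norm_one]
    _ ≤ 1 / (z.re ^ K / K.factorial) := by gcongr; exact h1.trans h2
    _ = _ := by rw [one_div_div]

theorem summable_one_div_mul_exp_sub_one {N : ℕ} (hN : 0 < N) :
    Summable (fun n : ℕ =>
      1 / (((n : ℝ) + 1) * (Real.exp (2 * Real.pi * ((n : ℝ) + 1) ^ N) - 1))) := by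
  have hs : Summable (fun n : ℕ => 1 / ((n : ℝ) + 1) ^ 2) := by
    have := (summable_nat_add_iff 1).2 (Real.summable_one_div_nat_pow.2 one_lt_two)
    simpa using this
  refine Summable.of_nonneg_of_le (fun n => ?_) (fun n => ?_) hs
  · have : 0 ≤ Real.exp (2 * Real.pi * ((n : ℝ) + 1) ^ N) - 1 := by
      rw [sub_nonneg, Real.one_le_exp_iff]
      have := Real.pi_pos
      positivity
    positivity
  · have h1 : (n : ℝ) + 1 ≤ Real.exp (2 * Real.pi * ((n : ℝ) + 1) ^ N) - 1 := by
      have h2 := Real.add_one_le_exp (2 * Real.pi * ((n : ℝ) + 1) ^ N)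
      have h3 : (n : ℝ) + 1 ≤ ((n : ℝ) + 1) ^ N := le_self_pow₀ (by simp) hN.ne'
      have h4 : (1 : ℝ) ≤ 2 * Real.pi := by linarith [Real.pi_gt_three]
      have h5 : 1 * ((n : ℝ) + 1) ^ N ≤ 2 * Real.pi * ((n : ℝ) + 1) ^ N := by gcongr
      linarith
    rw [pow_two]
    gcongr

/-- The exponential dominates the N-th power of its argument, which undoes the N-th root and leaves
a multiple of 1/(n+1)². -/
theorem summable_re_one_div_exp_sub_one {N : ℕ} (hN : 0 < N) {η : ℂ} (hη : 0 < η.re) :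
    Summable (fun n : ℕ => 1 / ((n : ℝ) + 1) * (1 / (Complex.exp (2 * Real.pi *
      ((((n : ℝ) + 1) ^ (1 / (N : ℝ)) : ℝ) * η)) - 1)).re) := by
  have hs : Summable (fun n : ℕ => (N.factorial / (2 * Real.pi * η.re) ^ N) *
      (1 / ((n : ℝ) + 1) ^ 2)) := by
    have := (summable_nat_add_iff 1).2 (Real.summable_one_div_nat_pow.2 one_lt_two)
    exact Summable.mul_left _ (by simpa using this)
  refine Summable.of_norm_bounded hs fun n => ?_
  have hpi := Real.pi_pos
  set a : ℝ := ((n : ℝ) + 1) ^ (1 / (N : ℝ)) with ha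
  have ha0 : 0 < a := by positivity
  have haN : a ^ N = (n : ℝ) + 1 := by
    rw [ha, one_div]
    exact Real.rpow_inv_natCast_pow (by positivity) hN.ne'
  have hre : (2 * Real.pi * (a * η) : ℂ).re = a * (2 * Real.pi * η.re) := by
    have : (2 * Real.pi * (a * η) : ℂ) = ((2 * Real.pi * a : ℝ) : ℂ) * η := by push_cast; ring
    rw [this, Complex.re_ofReal_mul]
    ring
  have hb := Complex.abs_re_one_div_exp_sub_one_le (z := 2 * Real.pi * (a * η))
    (by rw [hre]; positivity) hN
  rw [hre, mul_pow, haN] at hb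
  rw [norm_mul, Real.norm_of_nonneg (by positivity), Real.norm_eq_abs]
  calc _ ≤ 1 / ((n : ℝ) + 1) * (N.factorial / (((n : ℝ) + 1) * (2 * Real.pi * η.re) ^ N)) := by gcongr
    _ = _ := by field_simp

/-! ### The transformation formula. -/

/-- The logarithms cancel because log(P^N) = N log P. -/
theorem tendsto_harmonic_sub_harmonic_pow (N : ℕ) (hN : 0 < N) :
    Filter.Tendsto (fun P : ℕ => ∑ n ∈ Finset.range P, 1 / ((n : ℝ) + 1) -
      1 / N * ∑ m ∈ Finset.range (P ^ N), 1 / ((m : ℝ) + 1)) Filter.atTop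
      (nhds (Real.eulerMascheroniConstant - 1 / N * Real.eulerMascheroniConstant)) := by
  have h1 := Real.tendsto_harmonic_sub_log
  have h2 := (h1.comp (Filter.tendsto_pow_atTop (α := ℕ) hN.ne')).const_mul (1 / (N : ℝ))
  refine (h1.sub h2).congr fun P => ?_
  have hN0 : (N : ℝ) ≠ 0 := by exact_mod_cast hN.ne'
  have hh (n : ℕ) : ((harmonic n : ℚ) : ℝ) = ∑ i ∈ Finset.range n, 1 / ((i : ℝ) + 1) := by
    simp [harmonic]
  rw [Function.comp_apply, hh, hh]
  push_cast
  rw [Real.log_pow]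
  field_simp
  ring

theorem exists_rat_hasSum_one_div_pow_even {k : ℕ} (hk : 0 < k) :
    ∃ q : ℚ, q ≠ 0 ∧ HasSum (fun n : ℕ => 1 / ((n : ℝ) + 1) ^ (2 * k)) (q * Real.pi ^ (2 * k)) := by
  have h := hasSum_zeta_nat hk.ne'
  have h' := (hasSum_nat_add_iff' 1).2 h
  have hz : (1 : ℝ) / ((0 : ℕ) : ℝ) ^ (2 * k) = 0 := by simp [hk.ne']
  rw [Finset.sum_range_one, hz, sub_zero] at h'
  push_cast at h'
  refine ⟨(-1) ^ (k + 1) * 2 ^ (2 * k - 1) * bernoulli (2 * k) / (2 * k).factorial, ?_, ?_⟩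
  -- Nonvanishing is read off the series: its terms are nonnegative and the first is 1.
  · intro hq
    have hval : (-1 : ℝ) ^ (k + 1) * 2 ^ (2 * k - 1) * Real.pi ^ (2 * k) * (bernoulli (2 * k) : ℝ) /
        ((2 * k).factorial : ℝ) = 0 := by
      have : (((-1) ^ (k + 1) * 2 ^ (2 * k - 1) * bernoulli (2 * k) / (2 * k).factorial : ℚ) : ℝ) = 0 := by
        rw [hq]; simp
      push_cast at this
      linear_combination Real.pi ^ (2 * k) * this
    rw [hval] at h'
    have := (hasSum_zero_iff_of_nonneg (fun n => by positivity)).1 h'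
    have := congrFun this 0
    simp at this
  · refine (congrArg (HasSum _) ?_).mp h'
    push_cast
    ring

/-- The transformation formula relating the two families of Lambert-type series to Euler's constant
and an even zeta value. -/
theorem exists_rat_lambert_transformation {M : ℕ} (hM : 0 < M) :
    ∃ q : ℚ, q ≠ 0 ∧ (q : ℝ) * Real.pi ^ (2 * M + 1) =
      2 * ∑' n : ℕ, 1 / (((n : ℝ) + 1) * (Real.exp (2 * Real.pi * ((n : ℝ) + 1) ^ (2 * M + 1)) - 1)) +
      (1 - 1 / ((2 * M + 1 : ℕ) : ℝ)) * Real.eulerMascheroniConstant -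
      2 / ((2 * M + 1 : ℕ) : ℝ) * ∑ k ∈ Finset.range (2 * M + 1), (-1) ^ k *
        ∑' n : ℕ, 1 / ((n : ℝ) + 1) * (1 / (Complex.exp (2 * Real.pi *
          ((((n : ℝ) + 1) ^ (1 / ((2 * M + 1 : ℕ) : ℝ)) : ℝ) * halfPlaneRoot M k)) - 1)).re := by
  -- The rows contribute Σ 1/(2n^(N+1)), and N + 1 = 2(M+1) is even.
  obtain ⟨q, hq, hz⟩ := exists_rat_hasSum_one_div_pow_even (k := M + 1) M.succ_pos
  refine ⟨q, hq, ?_⟩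
  set N : ℕ := 2 * M + 1 with hN
  have hN0 : (N : ℝ) ≠ 0 := by positivity
  set S := ∑' n : ℕ, 1 / (((n : ℝ) + 1) * (Real.exp (2 * Real.pi * ((n : ℝ) + 1) ^ N) - 1))
  have hS := (summable_one_div_mul_exp_sub_one (N := N) (by omega)).hasSum.tendsto_sum_nat
  have hTs := tendsto_finsetSum (Finset.range N) fun k hk =>
    ((summable_re_one_div_exp_sub_one (N := N) (by omega)
      (halfPlaneRoot_re_pos (Finset.mem_range.1 hk))).hasSum.tendsto_sum_nat.comp
      (Filter.tendsto_pow_atTop (α := ℕ) (n := N) (by omega))).const_mul ((-1 : ℝ) ^ k)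
  have hlim := (((tendsto_harmonic_sub_harmonic_pow N (by omega)).const_mul (Real.pi / 2)).add
    (hS.const_mul Real.pi)).sub (hz.tendsto_sum_nat.const_mul (1 / 2))|>.sub
    (hTs.const_mul (Real.pi / N))
  have hzero := tendsto_sum_rows_sub_sum_columns (M := M) (fun n => hasSum_pow_div_row n M)
    (fun m => by
      have ha : (0 : ℝ) < ((m : ℝ) + 1) ^ (1 / (N : ℝ)) := by positivity
      have haN : (((m : ℝ) + 1) ^ (1 / (N : ℝ))) ^ (2 * M + 1) = (m : ℝ) + 1 := by
        rw [one_div]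
        exact Real.rpow_inv_natCast_pow (by positivity) (by omega)
      have := hasSum_pow_div_column hM ha
      rwa [haN] at this)
  -- Rows minus columns tends to 0 and also to the explicit combination in `hlim`; equating the two
  -- and cancelling one π gives the formula.
  have huniq := tendsto_nhds_unique hzero (hlim.congr fun P => ?_)
  · have hpi := Real.pi_pos.ne'
    have h2 : Real.pi ^ (2 * (M + 1)) = Real.pi ^ N * Real.pi := by rw [hN]; ring
    rw [h2] at huniq
    apply mul_right_cancel₀ hpi
    linear_combination 2 * huniq
  · have hNM : (2 * (M : ℝ) + 1) = (N : ℝ) := by rw [hN]; push_cast; ring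
    have hrow (n : ℕ) : 1 / ((n : ℝ) + 1) * (Real.pi / 2 +
        Real.pi * (1 / (Real.exp (2 * Real.pi * ((n : ℝ) + 1) ^ (2 * M + 1)) - 1)) -
        1 / (2 * ((n : ℝ) + 1) ^ (2 * M + 1))) =
        Real.pi / 2 * (1 / ((n : ℝ) + 1)) +
        Real.pi * (1 / (((n : ℝ) + 1) * (Real.exp (2 * Real.pi * ((n : ℝ) + 1) ^ N) - 1))) -
        1 / 2 * (1 / ((n : ℝ) + 1) ^ (2 * (M + 1))) := by
      rw [← hN, show 2 * (M + 1) = N + 1 by omega, one_div_mul_eq_div]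
      generalize Real.exp _ - 1 = E
      have : (n : ℝ) + 1 ≠ 0 := by positivity
      rw [pow_succ _ N]
      field_simp
    have hcol (m : ℕ) : Real.pi / ((2 * M + 1) * ((m : ℝ) + 1)) * (1 / 2 +
        ∑ k ∈ Finset.range (2 * M + 1), (-1) ^ k * (1 / (Complex.exp (2 * Real.pi *
          ((((m : ℝ) + 1) ^ (1 / (N : ℝ)) : ℝ) * halfPlaneRoot M k)) - 1)).re) =
        Real.pi / 2 * (1 / N) * (1 / ((m : ℝ) + 1)) + Real.pi / N *
        ∑ k ∈ Finset.range N, (-1) ^ k * (1 / ((m : ℝ) + 1) * (1 / (Complex.exp (2 * Real.pi *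
          ((((m : ℝ) + 1) ^ (1 / (N : ℝ)) : ℝ) * halfPlaneRoot M k)) - 1)).re) := by
      rw [hNM, ← hN]
      simp_rw [mul_left_comm ((-1 : ℝ) ^ _) (1 / ((m : ℝ) + 1))]
      rw [← Finset.mul_sum]
      have : (m : ℝ) + 1 ≠ 0 := by positivity
      field_simp
    simp_rw [hrow, hcol, Finset.sum_sub_distrib, Finset.sum_add_distrib, ← Finset.mul_sum]
    rw [Finset.sum_comm (s := Finset.range (P ^ (2 * M + 1)))]
    simp_rw [← Finset.mul_sum, Function.comp_apply, ← hN]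
    ring

/-! ### Reduction to the stated series, and the conclusion. -/

theorem halfPlaneRoot_add (M j : ℕ) :
    halfPlaneRoot M (M + j) =
      Complex.exp (Complex.I * Real.pi * j / ((2 * M + 1 : ℕ) : ℂ)) := by
  rw [halfPlaneRoot]
  congr 1
  push_cast
  ring

theorem halfPlaneRoot_sub {M j : ℕ} (hj : j ≤ M) :
    halfPlaneRoot M (M - j) = (starRingEnd ℂ) (halfPlaneRoot M (M + j)) := by
  rw [halfPlaneRoot, halfPlaneRoot, ← Complex.exp_conj, map_mul, Complex.conj_I, Complex.conj_ofReal,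
    Nat.cast_sub hj]
  congr 1
  push_cast
  ring

/-- The two roots are complex conjugates; hence the indices 0 ≤ j ≤ M account for all 2M+1 series.
-/
theorem re_one_div_exp_halfPlaneRoot_sub {M j : ℕ} (hj : j ≤ M) (r : ℝ) :
    (1 / (Complex.exp (2 * Real.pi * (r * halfPlaneRoot M (M - j))) - 1)).re =
      (1 / (Complex.exp (2 * Real.pi * (r * halfPlaneRoot M (M + j))) - 1)).re := by
  rw [halfPlaneRoot_sub hj, ← Complex.conj_re]
  congr 1
  simp [← Complex.exp_conj, Complex.conj_ofReal, map_ofNat (starRingEnd ℂ) 2]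

theorem tsum_pnat_re_one_div_exp_sub_one (M j : ℕ) :
    ∑' n : ℕ+, 1 / (n : ℝ) *
      (1 / (Complex.exp (2 * (Real.pi : ℂ) * (((n : ℝ) ^ (1 / ((2 * M + 1 : ℕ) : ℝ)) : ℝ) : ℂ) *
        Complex.exp (Complex.I * (Real.pi : ℂ) * (j : ℂ) / ((2 * M + 1 : ℕ) : ℂ))) - 1)).re =
    ∑' n : ℕ, 1 / ((n : ℝ) + 1) * (1 / (Complex.exp (2 * Real.pi *
      ((((n : ℝ) + 1) ^ (1 / ((2 * M + 1 : ℕ) : ℝ)) : ℝ) * halfPlaneRoot M (M + j))) - 1)).re := by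
  refine (tsum_pnat_eq_tsum_succ (f := fun n : ℕ => 1 / (n : ℝ) *
    (1 / (Complex.exp (2 * (Real.pi : ℂ) * (((n : ℝ) ^ (1 / ((2 * M + 1 : ℕ) : ℝ)) : ℝ) : ℂ) *
      Complex.exp (Complex.I * (Real.pi : ℂ) * (j : ℂ) / ((2 * M + 1 : ℕ) : ℂ))) - 1)).re)).trans
    (tsum_congr fun n => ?_)
  rw [halfPlaneRoot_add, ← mul_assoc, Nat.cast_add_one n]

theorem mainTheorem6 (N : ℕ) (hodd : Odd N) (hN : 1 < N) :
    -- convergence of the first series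
    Summable (fun n : ℕ+ =>
        1 / ((n : ℝ) * (Real.exp (2 * Real.pi * (n : ℝ) ^ N) - 1))) ∧
    -- convergence of the series indexed by `j`
    (∀ j : ℕ, j ≤ (N - 1) / 2 →
      Summable (fun n : ℕ+ => 1 / (n : ℝ) *
        (1 / (Complex.exp (2 * (Real.pi : ℂ) * (((n : ℝ) ^ (1 / (N : ℝ)) : ℝ) : ℂ) *
          Complex.exp (Complex.I * (Real.pi : ℂ) * (j : ℂ) / (N : ℂ))) - 1)).re)) ∧
    -- at least one of the numbers is transcendental
    (Transcendental ℚ Real.eulerMascheroniConstant ∨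
      Transcendental ℚ (∑' n : ℕ+,
        1 / ((n : ℝ) * (Real.exp (2 * Real.pi * (n : ℝ) ^ N) - 1))) ∨
      ∃ j : ℕ, j ≤ (N - 1) / 2 ∧
        Transcendental ℚ (∑' n : ℕ+, 1 / (n : ℝ) *
          (1 / (Complex.exp (2 * (Real.pi : ℂ) * (((n : ℝ) ^ (1 / (N : ℝ)) : ℝ) : ℂ) *
            Complex.exp (Complex.I * (Real.pi : ℂ) * (j : ℂ) / (N : ℂ))) - 1)).re)) := by
  obtain ⟨M, rfl⟩ := hodd
  have hM : 0 < M := by omega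
  have hMN : (2 * M + 1 - 1) / 2 = M := by omega
  rw [hMN]
  have hSsum := summable_one_div_mul_exp_sub_one (N := 2 * M + 1) (by omega)
  have hSpnat := tsum_pnat_eq_tsum_succ (f := fun n : ℕ =>
    1 / ((n : ℝ) * (Real.exp (2 * Real.pi * (n : ℝ) ^ (2 * M + 1)) - 1)))
  simp only [Nat.cast_add_one] at hSpnat
  refine ⟨?_, fun j hj => ?_, ?_⟩
  · refine (summable_pnat_iff_summable_succ (f := fun n : ℕ =>
      1 / ((n : ℝ) * (Real.exp (2 * Real.pi * (n : ℝ) ^ (2 * M + 1)) - 1)))).2 ?_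
    simpa only [Nat.cast_add_one] using hSsum
  · refine (summable_pnat_iff_summable_succ (f := fun n : ℕ => 1 / (n : ℝ) *
      (1 / (Complex.exp (2 * (Real.pi : ℂ) * (((n : ℝ) ^ (1 / ((2 * M + 1 : ℕ) : ℝ)) : ℝ) : ℂ) *
      Complex.exp (Complex.I * (Real.pi : ℂ) * (j : ℂ) / ((2 * M + 1 : ℕ) : ℂ))) - 1)).re)).2 ?_
    have := summable_re_one_div_exp_sub_one (N := 2 * M + 1) (by omega)
      (halfPlaneRoot_re_pos (M := M) (k := M + j) (by omega))
    refine this.congr fun n => ?_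
    rw [halfPlaneRoot_add, ← mul_assoc, Nat.cast_add_one n]
  · by_contra! hcon
    obtain ⟨hγ, hS, hT⟩ := hcon
    simp only [Transcendental, not_not] at hγ hS hT
    obtain ⟨q, hq, heq⟩ := exists_rat_lambert_transformation hM
    rw [hSpnat] at hS
    have hT' : ∀ k ∈ Finset.range (2 * M + 1), IsAlgebraic ℚ (∑' n : ℕ, 1 / ((n : ℝ) + 1) *
        (1 / (Complex.exp (2 * Real.pi * ((((n : ℝ) + 1) ^ (1 / ((2 * M + 1 : ℕ) : ℝ)) : ℝ) *
          halfPlaneRoot M k)) - 1)).re) := by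
      intro k hk
      have hk' := Finset.mem_range.1 hk
      rcases le_total M k with h | h
      · obtain ⟨j, rfl⟩ := Nat.exists_eq_add_of_le h
        have := hT j (by omega)
        rwa [tsum_pnat_re_one_div_exp_sub_one] at this
      · obtain ⟨j, hj⟩ := Nat.exists_eq_add_of_le h
        obtain rfl : k = M - j := by omega
        have := hT j (by omega)
        rw [tsum_pnat_re_one_div_exp_sub_one] at this
        simpa only [re_one_div_exp_halfPlaneRoot_sub (show j ≤ M by omega)] using this
    have halg : IsAlgebraic ℚ ((q : ℝ) * Real.pi ^ (2 * M + 1)) := by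
      rw [heq]
      have hnat (n : ℕ) : IsAlgebraic ℚ (n : ℝ) := isAlgebraic_natCast n
      have hdiv (n : ℕ) {x : ℝ} (hx : IsAlgebraic ℚ x) : IsAlgebraic ℚ (x / n) := by
        rw [div_eq_mul_inv]
        exact hx.mul (hnat n).inv
      refine ((IsAlgebraic.mul (by exact_mod_cast hnat 2) hS).add (IsAlgebraic.mul ?_ hγ)).sub
        (IsAlgebraic.mul (hdiv _ (by exact_mod_cast hnat 2)) (Finset.sum_induction _ (IsAlgebraic ℚ)
          (fun _ _ => IsAlgebraic.add) isAlgebraic_zero fun k hk => ?_))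
      · exact isAlgebraic_one.sub (hdiv _ isAlgebraic_one)
      · exact (isAlgebraic_one.neg.pow k).mul (hT' k hk)
    have hpow : IsAlgebraic ℚ (Real.pi ^ (2 * M + 1)) := by
      have := (isAlgebraic_algebraMap (A := ℝ) (q⁻¹ : ℚ)).mul halg
      have hq' : (q : ℝ) ≠ 0 := by exact_mod_cast hq
      simpa [hq'] using this
    exact Real.transcendental_pi (hpow.of_pow (by omega))
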